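/- Let $X_1, X_2$ be Hausdorff, locally compact, second countable topological spaces with Borel $\sigma$-algebras $\mathcal{B}(X_i)$, and let $\mathcal{H}$ be a complex Hilbert space. A (normalized) POVM on a measurable space $X$ acting in $\mathcal{H}$ is a map $F$ from the $\sigma$-algebra of $X$ to the positive bounded operators on $\mathcal{H}$ which is countably additive in the weak operator topology and satisfies $F(X)=\mathbf{1}$. It is a PVM if $F(\Delta)F(\Delta')=\mathbf{0}$ whenever $\Delta\cap\Delta'=\emptyset$. Let $F_1:\mathcal{B}(X_1)\to\mathcal{L}_s^+(\mathcal{H})$ and $F_2:\mathcal{B}(X_2)\to\mathcal{L}_s^+(\mathcal{H})$ be POVMs. Then the following are equivalent: (i) $F_1$ and $F_2$ are compatible, i.e. there is a POVM $F$ on $X_1\times X_2$ (with the product $\sigma$-algebra) acting in $\mathcal{H}$ such that $F_1(\Delta_1)=F(\Delta_1\times X_2)$ for all $\Delta_1\in\mathcal{B}(X_1)$ and $F_2(\Delta_2)=F(X_1\times\Delta_2)$ for all $\Delta_2\in\mathcal{B}(X_2)$; (ii) $F_1$ and $F_2$ have commuting Naimark dilations in a common extended Hilbert space, i.e. there are a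 complex Hilbert space $\mathcal{H}^+$ containing $\mathcal{H}$ (through a linear isometry) as a closed subspace, with orthogonal projection $P$ of $\mathcal{H}^+$ onto $\mathcal{H}$, and PVMs $E_1^+$ on $\mathcal{B}(X_1)$ and $E_2^+$ on $\mathcal{B}(X_2)$ acting in $\mathcal{H}^+$, such that $F_i(\Delta)\psi=PE_i^+(\Delta)\psi$ for all $\Delta\in\mathcal{B}(X_i)$, $\psi\in\mathcal{H}$, $i=1,2$, and $E_1^+(\Delta_1)E_2^+(\Delta_2)=E_2^+(\Delta_2)E_1^+(\Delta_1)$ for all $\Delta_1\in\mathcal{B}(X_1)$, $\Delta_2\in\mathcal{B}(X_2)$. -/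

import Mathlib

open MeasureTheory

universe u v w x

noncomputable section

/-- A (normalized) positive operator valued measure on a measurable space `X`, acting in a complex
Hilbert space `H`: a measure with values in the bounded operators on `H`, countably additive for the
weak operator topology, with positive values, and such that `F(X)` is the identity. -/
structure POVM (X : Type*) [MeasurableSpace X] (H : Type*) [NormedAddCommGroup H]
    [InnerProductSpace ℂ H] where
  /-- the underlying measure, countably additive in the weak operator topology
  (with the convention that it is zero on non-measurable sets) -/
  measure : VectorMeasure X (H →WOT[ℂ] H)
  isPositive : ∀ Δ : Set X, MeasurableSet Δ → (measure Δ).toCLM.IsPositive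
  normalized : (measure Set.univ).toCLM = ContinuousLinearMap.id ℂ H

/-- The range of a linear isometry defined on a Hilbert space is a closed subspace, so that it has an
orthogonal projection. -/
instance LinearIsometry.hasOrthogonalProjection_range {H : Type*} [NormedAddCommGroup H]
    [InnerProductSpace ℂ H] [CompleteSpace H] {K : Type*} [NormedAddCommGroup K]
    [InnerProductSpace ℂ K] (V : H →ₗᵢ[ℂ] K) :
    (LinearMap.range V.toLinearMap).HasOrthogonalProjection := by
  have : CompleteSpace (LinearMap.range V.toLinearMap) := by
    have h := V.isometry.isUniformInducing.isComplete_range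
    exact h.completeSpace_coe
  infer_instance

namespace POVM

section Basic

variable {X : Type*} [MeasurableSpace X] {H : Type*} [NormedAddCommGroup H] [InnerProductSpace ℂ H]

/-- The bounded operator `F(Δ)`. -/
def op (F : POVM X H) (Δ : Set X) : H →L[ℂ] H :=
  (F.measure Δ).toCLM

/-- A projection valued measure (spectral measure): an orthogonal normalized POVM. -/
def IsPVM (E : POVM X H) : Prop :=
  ∀ Δ₁ Δ₂ : Set X, MeasurableSet Δ₁ → MeasurableSet Δ₂ → Δ₁ ∩ Δ₂ = ∅ →
    E.op Δ₁ ∘L E.op Δ₂ = 0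

/-- `E` (acting in `K`) is a Naimark dilation of `F` (acting in `H`), where `H` is regarded as a
closed subspace of `K` through the linear isometry `V : H → K`: `E` is a PVM and
`F(Δ)ψ = P E(Δ) ψ` for all `ψ ∈ H`, with `P` the orthogonal projection of `K` onto (the copy
of) `H`. -/
def IsNaimarkDilation [CompleteSpace H] {K : Type*} [NormedAddCommGroup K] [InnerProductSpace ℂ K]
    (V : H →ₗᵢ[ℂ] K) (E : POVM X K) (F : POVM X H) : Prop :=
  E.IsPVM ∧ ∀ Δ : Set X, MeasurableSet Δ → ∀ ψ : H,
    V (F.op Δ ψ) = (LinearMap.range V.toLinearMap).starProjection (E.op Δ (V ψ))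

end Basic

section Two

variable {X₁ X₂ : Type*} [MeasurableSpace X₁] [MeasurableSpace X₂]
  {H : Type*} [NormedAddCommGroup H] [InnerProductSpace ℂ H]

/-- Two POVMs acting in the same Hilbert space commute: `[F₁(Δ₁), F₂(Δ₂)] = 0` for all `Δ₁, Δ₂`. -/
def Commutes (F₁ : POVM X₁ H) (F₂ : POVM X₂ H) : Prop :=
  ∀ (Δ₁ : Set X₁) (Δ₂ : Set X₂), MeasurableSet Δ₁ → MeasurableSet Δ₂ →
    F₁.op Δ₁ ∘L F₂.op Δ₂ = F₂.op Δ₂ ∘L F₁.op Δ₁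

/-- Two POVMs are compatible (jointly measurable) if they are the marginals of a joint POVM on the
product σ-algebra of `X₁ × X₂`. -/
def Compatible (F₁ : POVM X₁ H) (F₂ : POVM X₂ H) : Prop :=
  ∃ F : POVM (X₁ × X₂) H,
    (∀ Δ₁ : Set X₁, MeasurableSet Δ₁ → F₁.op Δ₁ = F.op (Δ₁ ×ˢ Set.univ)) ∧
    (∀ Δ₂ : Set X₂, MeasurableSet Δ₂ → F₂.op Δ₂ = F.op (Set.univ ×ˢ Δ₂))

end Two

end POVM

end

/-!
Compatibility of two POVMs is equivalent to the existence of commuting Naimark dilations.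

*From a joint POVM to commuting dilations.* A joint POVM `F` on `X₁ × X₂` has a Naimark dilation
`E` (`POVM.exists_naimark`), and the marginals of the PVM `E` are dilations of `F₁` and `F₂` which
commute, because `E(s)E(t) = E(s ∩ t)`. The dilation space is the completion of the space of formal
sums `∑ χ_A ⊗ x` for the scalar product `⟪χ_A ⊗ x, χ_B ⊗ y⟫ = ⟪x, F(A ∩ B) y⟫`, and `E(s)` is the
multiplication by `χ_s`. The scalar product is positive semidefinite by
`POVM.sum_inner_op_inter_nonneg`. The countable additivity of `E` is clear on formal sums, and
passes to the completion because finite sums of the projections are contractions.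

*From commuting dilations to a joint POVM.* If the PVMs `E₁` and `E₂` commute, then
`⟪E₁(s)E₂(t)Vx, Vx⟫ = ‖E₁(s)E₂(t)Vx‖²` is nonnegative and is a measure in each of the variables `s`
and `t`. Such a bimeasure extends to a measure `μ x` on the product
(`IsBimeasure.exists_measure`); this is where the topological assumptions enter. They allow both
spaces to be embedded measurably in the Cantor space, where rectangles of cylinders are clopen: the
bimeasure is approximated by atomic measures which have the prescribed values on more and more of
these rectangles, and any limit point, which exists by the compactness of the space of probability
measures, has the prescribed value on all of them. Finally, the sets `A` for which `x ↦ μ x A` is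
the quadratic form of a bounded operator contain the rectangles and form a λ-system
(`POVM.exists_of_measures`), since a pointwise limit of quadratic forms of symmetric bounded
operators is of the same kind (`exists_tendsto_inner_of_isSymmetric`). The operators so obtained
are the values of the joint POVM.
-/

section CompatibleIffDilation

open Filter Topology Set
open scoped InnerProductSpace ENNReal

/-! ### Quadratic forms and weak limits of operators -/

section Operators

variable {H : Type*} [NormedAddCommGroup H] [InnerProductSpace ℂ H]

/-- By polarization, the convergence of the quadratic forms of a sequence of operators implies the
convergence of the sesquilinear forms. -/
theorem exists_tendsto_inner_of_inner_self {ι : Type*} {l : Filter ι} {T : ι → H →L[ℂ] H}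
    (h : ∀ x, ∃ a, Tendsto (fun i => ⟪T i x, x⟫_ℂ) l (𝓝 a)) (x y : H) :
    ∃ a, Tendsto (fun i => ⟪T i x, y⟫_ℂ) l (𝓝 a) := by
  choose q hq using h
  have key := fun i => inner_map_polarization' (T i : H →ₗ[ℂ] H) x y
  simp only [ContinuousLinearMap.coe_coe] at key
  simp only [key]
  exact ⟨_, ((((hq _).sub (hq _)).sub ((hq _).const_mul Complex.I)).add
    ((hq _).const_mul Complex.I)).div_const 4⟩

theorem hasSum_inner_of_hasSum_inner_self {ι : Type*} {T : ι → H →L[ℂ] H} {S : H →L[ℂ] H}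
    (h : ∀ x, HasSum (fun i => ⟪T i x, x⟫_ℂ) ⟪S x, x⟫_ℂ) (x y : H) :
    HasSum (fun i => ⟪T i x, y⟫_ℂ) ⟪S x, y⟫_ℂ := by
  have key := fun A : H →L[ℂ] H => inner_map_polarization' (A : H →ₗ[ℂ] H) x y
  simp only [ContinuousLinearMap.coe_coe] at key
  simp only [key]
  exact ((((h _).sub (h _)).sub ((h _).mul_left Complex.I)).add
    ((h _).mul_left Complex.I)).div_const 4

theorem ContinuousLinearMap.ext_inner_self {S T : H →L[ℂ] H}
    (h : ∀ x, ⟪S x, x⟫_ℂ = ⟪T x, x⟫_ℂ) : S = T := by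
  have := (ext_inner_map (S : H →ₗ[ℂ] H) T).1 h
  exact ContinuousLinearMap.coe_injective this

/-- A sequence of symmetric operators on a Hilbert space whose quadratic forms converge pointwise
converges weakly to a bounded operator: the Riesz representation of the limit of the
sesquilinear forms exists by the Banach–Steinhaus theorem, and the resulting symmetric operator is
bounded by the Hellinger–Toeplitz theorem. -/
theorem exists_tendsto_inner_of_isSymmetric [CompleteSpace H] {S : ℕ → H →L[ℂ] H}
    (hS : ∀ n, (S n).IsSymmetric)
    (h : ∀ x, ∃ a, Tendsto (fun n => ⟪S n x, x⟫_ℂ) atTop (𝓝 a)) :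
    ∃ T : H →L[ℂ] H, ∀ x, Tendsto (fun n => ⟪S n x, x⟫_ℂ) atTop (𝓝 ⟪T x, x⟫_ℂ) := by
  choose L hL using exists_tendsto_inner_of_inner_self h
  have hex : ∀ x, ∃ z : H, ∀ y, ⟪z, y⟫_ℂ = L x y := by
    intro x
    have ht : Tendsto (fun n y => (innerSL ℂ (S n x)) y) atTop (𝓝 (L x)) :=
      tendsto_pi_nhds.2 fun y => by simpa using hL x y
    refine ⟨(InnerProductSpace.toDual ℂ H).symm
      (continuousLinearMapOfTendsto (fun n => innerSL ℂ (S n x)) ht), fun y => ?_⟩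
    rw [InnerProductSpace.toDual_symm_apply]
    rfl
  choose T hT using hex
  have hlim : ∀ x y, Tendsto (fun n => ⟪S n x, y⟫_ℂ) atTop (𝓝 ⟪T x, y⟫_ℂ) := fun x y => by
    rw [hT]; exact hL x y
  let T' : H →ₗ[ℂ] H :=
    { toFun := T
      map_add' := fun x x' => ext_inner_right ℂ fun y => by
        rw [inner_add_left]
        refine tendsto_nhds_unique (hlim _ y) ?_
        simpa only [map_add, inner_add_left] using (hlim x y).add (hlim x' y)
      map_smul' := fun c x => ext_inner_right ℂ fun y => by
        rw [inner_smul_left]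
        refine tendsto_nhds_unique (hlim _ y) ?_
        simpa only [map_smul, inner_smul_left, RingHom.id_apply] using (hlim x y).const_mul _ }
  have hsym : T'.IsSymmetric := fun x y => by
    refine tendsto_nhds_unique (hlim x y) ?_
    have h1 : Tendsto (fun n => (starRingEnd ℂ) ⟪S n y, x⟫_ℂ) atTop
        (𝓝 ((starRingEnd ℂ) ⟪T y, x⟫_ℂ)) :=
      (Complex.continuous_conj.tendsto _).comp (hlim y x)
    simp only [inner_conj_symm] at h1
    refine h1.congr fun n => ?_
    exact (hS n x y).symm
  exact ⟨⟨T', hsym.continuous⟩, fun x => hlim x x⟩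

theorem ContinuousLinearMapWOT.toCLM_finsetSum {ι : Type*} (s : Finset ι) (f : ι → H →WOT[ℂ] H) :
    (∑ b ∈ s, f b).toCLM = ∑ b ∈ s, (f b).toCLM :=
  map_sum (ContinuousLinearMapWOT.addEquiv (σ := RingHom.id ℂ) (E := H) (F := H)) f s

theorem LinearMap.IsSymmetric.norm_apply_le_of_idempotent {E : Type*} [SeminormedAddCommGroup E]
    [InnerProductSpace ℂ E] {T : E →ₗ[ℂ] E} (hT : T.IsSymmetric) (hT2 : ∀ x, T (T x) = T x)
    (x : E) : ‖T x‖ ≤ ‖x‖ := by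
  have h1 : ‖T x‖ * ‖T x‖ ≤ ‖x‖ * ‖T x‖ := by
    rw [← inner_self_eq_norm_mul_norm (𝕜 := ℂ), hT, hT2]
    exact (re_inner_le_norm x (T x))
  by_contra! h
  have h0 : 0 < ‖T x‖ := (norm_nonneg x).trans_lt h
  exact absurd (le_of_mul_le_mul_right h1 h0) (not_le.2 h)

/-- Weak convergence of a bounded family of operators can be tested on a dense set of vectors. -/
theorem tendsto_inner_of_dense {K : Type*} [NormedAddCommGroup K] [InnerProductSpace ℂ K]
    {ι : Type*} {l : Filter ι} {T : ι → K →L[ℂ] K} {S : K →L[ℂ] K}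
    (hT : ∀ i x, ‖T i x‖ ≤ ‖x‖) {D : Set K} (hD : Dense D)
    (h : ∀ x ∈ D, ∀ y ∈ D, Tendsto (fun i => ⟪T i x, y⟫_ℂ) l (𝓝 ⟪S x, y⟫_ℂ)) (x y : K) :
    Tendsto (fun i => ⟪T i x, y⟫_ℂ) l (𝓝 ⟪S x, y⟫_ℂ) := by
  have h1 : ∀ y ∈ D, ∀ x, Tendsto (fun i => ⟪T i x, y⟫_ℂ) l (𝓝 ⟪S x, y⟫_ℂ) := by
    intro y hy x
    have heq : Equicontinuous fun i x => ⟪T i x, y⟫_ℂ := by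
      refine (LipschitzWith.uniformEquicontinuous _ ‖y‖₊ fun i =>
        LipschitzWith.of_dist_le_mul fun a b => ?_).equicontinuous
      rw [dist_eq_norm, dist_eq_norm, ← inner_sub_left, ← map_sub, coe_nnnorm, mul_comm]
      exact (norm_inner_le_norm _ _).trans (mul_le_mul_of_nonneg_right (hT _ _) (norm_nonneg _))
    have hcl := heq.isClosed_setOfPred_tendsto (l := l) (f := fun x => ⟪S x, y⟫_ℂ) (by fun_prop)
    exact hcl.closure_subset_iff.2 (fun x hx => h x hx y hy) (hD x)
  have heq : Equicontinuous fun i y => ⟪T i x, y⟫_ℂ := by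
    refine (LipschitzWith.uniformEquicontinuous _ ‖x‖₊ fun i =>
      LipschitzWith.of_dist_le_mul fun a b => ?_).equicontinuous
    rw [dist_eq_norm, dist_eq_norm, ← inner_sub_right, coe_nnnorm]
    exact (norm_inner_le_norm _ _).trans (mul_le_mul_of_nonneg_right (hT _ _) (norm_nonneg _))
  have hcl := heq.isClosed_setOfPred_tendsto (l := l) (f := fun y => ⟪S x, y⟫_ℂ) (by fun_prop)
  exact hcl.closure_subset_iff.2 (fun y hy => h1 y hy x) (hD y)

end Operators

/-! ### POVMs and their scalar measures -/

namespace POVM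
variable {X : Type*} [MeasurableSpace X] {H : Type*} [NormedAddCommGroup H] [InnerProductSpace ℂ H]

theorem op_isPositive (F : POVM X H) {s : Set X} (hs : MeasurableSet s) : (F.op s).IsPositive :=
  F.isPositive s hs

theorem inner_op_comm (F : POVM X H) {s : Set X} (hs : MeasurableSet s) (x y : H) :
    ⟪F.op s x, y⟫_ℂ = ⟪x, F.op s y⟫_ℂ :=
  (F.op_isPositive hs).isSymmetric x y

theorem op_univ (F : POVM X H) : F.op univ = ContinuousLinearMap.id ℂ H := F.normalized

theorem op_empty (F : POVM X H) : F.op ∅ = 0 := by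
  simp [op]

theorem op_union (F : POVM X H) {s t : Set X} (h : Disjoint s t) (hs : MeasurableSet s)
    (ht : MeasurableSet t) : F.op (s ∪ t) = F.op s + F.op t := by
  simp [op, VectorMeasure.of_union h hs ht]

theorem op_biUnion_finset (F : POVM X H) {ι : Type*} {s : Finset ι} {f : ι → Set X}
    (hd : (s : Set ι).PairwiseDisjoint f) (hm : ∀ b ∈ s, MeasurableSet (f b)) :
    F.op (⋃ b ∈ s, f b) = ∑ b ∈ s, F.op (f b) := by
  simp only [op, VectorMeasure.of_biUnion_finset (v := F.measure) hd hm,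
    ContinuousLinearMapWOT.toCLM_finsetSum]

theorem hasSum_inner_op (F : POVM X H) {f : ℕ → Set X} (hm : ∀ i, MeasurableSet (f i))
    (hd : Pairwise (Function.onFun Disjoint f)) (x y : H) :
    HasSum (fun i => ⟪x, F.op (f i) y⟫_ℂ) ⟪x, F.op (⋃ i, f i) y⟫_ℂ := by
  have h := F.measure.m_iUnion hm hd
  have h2 := ContinuousLinearMapWOT.tendsto_iff_forall_dual_apply_tendsto.1 h y (innerSL ℂ x)
  refine h2.congr fun s => ?_
  have h4 : (∑ b ∈ s, F.measure (f b)) y = ∑ b ∈ s, F.op (f b) y := by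
    rw [← ContinuousLinearMapWOT.toCLM_apply, ContinuousLinearMapWOT.toCLM_finsetSum, sum_apply]
    rfl
  rw [h4]
  simp

open Classical in
/-- The POVM given on measurable sets by a family of positive operators whose quadratic
forms are countably additive. -/
noncomputable def ofOp [CompleteSpace H] (T : Set X → H →L[ℂ] H)
    (hpos : ∀ s, MeasurableSet s → (T s).IsPositive)
    (huniv : T univ = ContinuousLinearMap.id ℂ H)
    (hsum : ∀ f : ℕ → Set X, (∀ i, MeasurableSet (f i)) → Pairwise (Function.onFun Disjoint f) →
      ∀ x, HasSum (fun i => ⟪T (f i) x, x⟫_ℂ) ⟪T (⋃ i, f i) x, x⟫_ℂ) : POVM X H where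
  measure :=
    { measureOf' := fun s => if MeasurableSet s then .ofCLM (T s) else 0
      empty' := by
        simp only [MeasurableSet.empty, if_true]
        have h0 : T ∅ = 0 := by
          refine ContinuousLinearMap.ext_inner_self fun x => ?_
          have := hsum (fun _ => ∅) (fun _ => .empty) (fun _ _ _ => disjoint_bot_left) x
          have h1 := (summable_const_iff _).1 this.summable
          simpa using h1
        rw [h0]; rfl
      not_measurable' := fun s hs => if_neg hs
      m_iUnion' := fun f hm hd => by
        refine ContinuousLinearMapWOT.tendsto_iff_forall_dual_apply_tendsto.2 fun x φ => ?_
        obtain ⟨y, rfl⟩ := (InnerProductSpace.toDual ℂ H).surjective φ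
        simp only [hm, MeasurableSet.iUnion hm, if_true]
        have h1 := (hasSum_inner_of_hasSum_inner_self (hsum f hm hd) y x)
        have h2 : ∀ s, MeasurableSet s → ⟪T s y, x⟫_ℂ = ⟪y, T s x⟫_ℂ := fun s hs =>
          (hpos s hs).isSymmetric y x
        rw [h2 _ (MeasurableSet.iUnion hm)] at h1
        refine Tendsto.congr (fun s => ?_) h1
        rw [← ContinuousLinearMapWOT.toCLM_apply, ContinuousLinearMapWOT.toCLM_finsetSum, sum_apply]
        simp [h2 _ (hm _)] }
  isPositive := fun s hs => by
    change ContinuousLinearMap.IsPositive (ContinuousLinearMapWOT.toCLM (if _ then _ else _))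
    rw [if_pos hs]
    exact hpos s hs
  normalized := by
    change ContinuousLinearMapWOT.toCLM (if _ then _ else _) = _
    rw [if_pos MeasurableSet.univ]
    exact huniv

theorem op_ofOp [CompleteSpace H] (T : Set X → H →L[ℂ] H) (hpos huniv hsum) {s : Set X}
    (hs : MeasurableSet s) : (ofOp T hpos huniv hsum).op s = T s := by
  classical
  change ContinuousLinearMapWOT.toCLM (if _ then _ else _) = _
  rw [if_pos hs]

/-- The image of a POVM under a measurable map. -/
noncomputable def map {Y : Type*} [MeasurableSpace Y] (F : POVM X H) (f : X → Y) (hf : Measurable f) :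
    POVM Y H where
  measure := F.measure.map f
  isPositive := fun s hs => by
    rw [VectorMeasure.map_apply _ hf hs]
    exact F.isPositive _ (hf hs)
  normalized := by
    rw [VectorMeasure.map_apply _ hf .univ]
    exact F.normalized

theorem op_map {Y : Type*} [MeasurableSpace Y] (F : POVM X H) {f : X → Y} (hf : Measurable f)
    {s : Set Y} (hs : MeasurableSet s) : (F.map f hf).op s = F.op (f ⁻¹' s) := by
  simp only [op, map]
  rw [VectorMeasure.map_apply _ hf hs]

theorem re_inner_op_self_nonneg (F : POVM X H) {s : Set X} (hs : MeasurableSet s) (x : H) :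
    0 ≤ (⟪F.op s x, x⟫_ℂ).re :=
  ((ContinuousLinearMap.isPositive_iff_complex _).1 (F.op_isPositive hs) x).2

/-- The finite measure `s ↦ ⟪F(s)x, x⟫`. -/
noncomputable def scalarMeasure (F : POVM X H) (x : H) : Measure X :=
  Measure.ofMeasurable (fun s _ => ENNReal.ofReal (⟪F.op s x, x⟫_ℂ).re)
    (by simp [op_empty]) (by
      intro f hm hd
      have h := F.hasSum_inner_op hm hd x x
      simp only [← F.inner_op_comm (hm _), ← F.inner_op_comm (MeasurableSet.iUnion hm)] at h
      have h2 := (Complex.hasSum_iff _ _).1 h |>.1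
      rw [← h2.tsum_eq, ENNReal.ofReal_tsum_of_nonneg (fun i => F.re_inner_op_self_nonneg (hm i) x)
        h2.summable])

theorem scalarMeasure_apply (F : POVM X H) (x : H) {s : Set X} (hs : MeasurableSet s) :
    F.scalarMeasure x s = ENNReal.ofReal (⟪F.op s x, x⟫_ℂ).re :=
  Measure.ofMeasurable_apply s hs

/-- A family of finite measures `μ x`, indexed by the vectors of a Hilbert space, with
`μ x univ = ‖x‖²`, is the family of scalar measures of a POVM as soon as `x ↦ μ x s` is the
quadratic form of a bounded operator for the sets `s` of a generating π-system. -/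
theorem exists_of_measures [CompleteSpace H] (μ : H → Measure X) [∀ x, IsFiniteMeasure (μ x)]
    (huniv : ∀ x, (μ x).real univ = ‖x‖ ^ 2) (C : Set (Set X))
    (hgen : ‹MeasurableSpace X› = MeasurableSpace.generateFrom C) (hC : IsPiSystem C)
    (hop : ∀ s ∈ C, ∃ T : H →L[ℂ] H, ∀ x, ⟪T x, x⟫_ℂ = (μ x).real s) :
    ∃ F : POVM X H, ∀ s, MeasurableSet s → ∀ x, ⟪F.op s x, x⟫_ℂ = (μ x).real s := by
  have huniv' : ∀ x, ⟪ContinuousLinearMap.id ℂ H x, x⟫_ℂ = (μ x).real univ := fun x => by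
    rw [huniv, ContinuousLinearMap.id_apply, inner_self_eq_norm_sq_to_K]
    simp
  have hposT : ∀ (T : H →L[ℂ] H) (s : Set X), (∀ x, ⟪T x, x⟫_ℂ = (μ x).real s) →
      T.IsPositive := fun T s h => by
    refine (ContinuousLinearMap.isPositive_iff_complex _).2 fun x => ?_
    rw [h]
    simp
  have hsumμ : ∀ f : ℕ → Set X, (∀ i, MeasurableSet (f i)) →
      Pairwise (Function.onFun Disjoint f) → ∀ x,
      HasSum (fun i => (((μ x).real (f i) : ℝ) : ℂ)) ((μ x).real (⋃ i, f i)) :=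
    fun f hm hd x => by
      have h := (μ x).toSignedMeasure.m_iUnion hm hd
      simp only [Measure.toSignedMeasure_apply_measurable (hm _),
        Measure.toSignedMeasure_apply_measurable (MeasurableSet.iUnion hm)] at h
      exact Complex.hasSum_ofReal.2 h
  have hall : ∀ s, MeasurableSet s → ∃ T : H →L[ℂ] H, ∀ x, ⟪T x, x⟫_ℂ = (μ x).real s := by
    refine fun s hs => MeasurableSpace.induction_on_inter (C := fun s _ =>
      ∃ T : H →L[ℂ] H, ∀ x, ⟪T x, x⟫_ℂ = (μ x).real s) hgen hC ⟨0, by simp⟩ hop ?_ ?_ s hs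
    · rintro t ht ⟨T, hT⟩
      refine ⟨ContinuousLinearMap.id ℂ H - T, fun x => ?_⟩
      rw [sub_apply, inner_sub_left, hT, huniv',
        measureReal_compl ht]
      simp
    · intro f hd hm hT
      choose T hT using hT
      have hS : ∀ n x, ⟪(∑ i ∈ Finset.range n, T i) x, x⟫_ℂ
          = ∑ i ∈ Finset.range n, (((μ x).real (f i) : ℝ) : ℂ) := fun n x => by
        rw [sum_apply, sum_inner]
        exact Finset.sum_congr rfl fun i _ => hT i x
      have hlim : ∀ x, Tendsto (fun n => ⟪(∑ i ∈ Finset.range n, T i) x, x⟫_ℂ) atTop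
          (𝓝 ((μ x).real (⋃ i, f i))) := fun x => by
        simp only [hS]
        exact (hsumμ f hm hd x).tendsto_sum_nat
      obtain ⟨S, hS'⟩ := exists_tendsto_inner_of_isSymmetric
        (S := fun n => ∑ i ∈ Finset.range n, T i) (fun n => by
          refine ContinuousLinearMap.IsPositive.isSymmetric ?_
          exact ContinuousLinearMap.isPositive_sum _ fun i _ => hposT _ _ (hT i))
        (fun x => ⟨_, hlim x⟩)
      exact ⟨S, fun x => tendsto_nhds_unique (hS' x) (hlim x)⟩
  classical
  let T : Set X → H →L[ℂ] H := fun s => if hs : MeasurableSet s then (hall s hs).choose else 0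
  have hT : ∀ s, MeasurableSet s → ∀ x, ⟪T s x, x⟫_ℂ = (μ x).real s := fun s hs => by
    simp only [T, dif_pos hs]
    exact (hall s hs).choose_spec
  refine ⟨ofOp T (fun s hs => hposT _ s (hT s hs)) ?_ ?_, fun s hs x => ?_⟩
  · exact ContinuousLinearMap.ext_inner_self fun x => by rw [hT _ .univ, huniv']
  · intro f hm hd x
    simp only [hT _ (hm _), hT _ (MeasurableSet.iUnion hm)]
    exact hsumμ f hm hd x
  · rw [op_ofOp _ _ _ _ hs, hT s hs]

end POVM

/-! ### Extension of bimeasures to measures -/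

section Bimeasure

/-- A locally compact, Hausdorff, second countable space embeds measurably into the Cantor space:
it is σ-compact, hence a Borel subset of its completion for any compatible metric. -/
theorem exists_measurableEmbedding_natBool (X : Type*) [TopologicalSpace X] [T2Space X]
    [LocallyCompactSpace X] [SecondCountableTopology X] [MeasurableSpace X] [BorelSpace X] :
    ∃ f : X → ℕ → Bool, MeasurableEmbedding f := by
  let : MetricSpace X := TopologicalSpace.metrizableSpaceMetric X
  let : MeasurableSpace (UniformSpace.Completion X) := borel _
  have : BorelSpace (UniformSpace.Completion X) := ⟨rfl⟩
  have he : IsEmbedding ((↑) : X → UniformSpace.Completion X) :=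
    UniformSpace.Completion.coe_isometry.isEmbedding
  have hr : MeasurableSet (range ((↑) : X → UniformSpace.Completion X)) := by
      obtain ⟨K, hK, hKu⟩ := isSigmaCompact_range he.continuous
      rw [← hKu]
      exact MeasurableSet.iUnion fun n => (hK n).measurableSet
  have h1 := he.measurableEmbedding hr
  have h2 : MeasurableEmbedding (MeasurableSpace.mapNatBool (UniformSpace.Completion X)) :=
    (MeasurableSpace.measurable_mapNatBool _).measurableEmbedding
      (MeasurableSpace.injective_mapNatBool _)
  exact ⟨_, h2.comp h1⟩

/-- The point of the Cantor space with given first `n` coordinates and the others `false`. -/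
def extendFalse (n : ℕ) (a : Fin n → Bool) : ℕ → Bool :=
  fun k => if h : k < n then a ⟨k, h⟩ else false

/-- The first `n` coordinates of a point of the Cantor space. -/
def firstCoords (n : ℕ) (x : ℕ → Bool) : Fin n → Bool := fun k => x k

theorem measurable_firstCoords (n : ℕ) : Measurable (firstCoords n) :=
  measurable_pi_lambda _ fun _ => measurable_pi_apply _

theorem mem_cylinder_extendFalse_iff {I : Finset ℕ} {n : ℕ} (hn : ∀ i ∈ I, i < n)
    (S : Set (I → Bool)) (x : ℕ → Bool) :
    extendFalse n (firstCoords n x) ∈ cylinder I S ↔ x ∈ cylinder I S := by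
  have : I.restrict (extendFalse n (firstCoords n x)) = I.restrict x := by
    ext ⟨i, hi⟩
    simp [extendFalse, firstCoords, hn i hi]
  simp only [mem_cylinder]
  rw [this]

theorem isClopen_cylinder_bool (I : Finset ℕ) (S : Set (I → Bool)) :
    IsClopen (cylinder (α := fun _ => Bool) I S) :=
  (isClopen_discrete S).preimage (Finset.continuous_restrict I)

/-- A set function of two variables which is a measure in each variable when the other one is
fixed (and measurable): a bimeasure with values in `[0, ∞]`. -/
structure IsBimeasure {X Y : Type*} [MeasurableSpace X] [MeasurableSpace Y]
    (B : Set X → Set Y → ℝ≥0∞) : Prop where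
  left : ∀ t, MeasurableSet t → ∃ μ : Measure X, ∀ s, MeasurableSet s → μ s = B s t
  right : ∀ s, MeasurableSet s → ∃ μ : Measure Y, ∀ t, MeasurableSet t → μ t = B s t

namespace IsBimeasure

section

variable {X Y : Type*} [MeasurableSpace X] [MeasurableSpace Y] {B : Set X → Set Y → ℝ≥0∞}

theorem le_univ (hB : IsBimeasure B) {s : Set X} {t : Set Y} (hs : MeasurableSet s)
    (ht : MeasurableSet t) : B s t ≤ B univ univ := by
  obtain ⟨μ, hμ⟩ := hB.left t ht
  obtain ⟨ν, hν⟩ := hB.right univ .univ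
  calc B s t = μ s := (hμ s hs).symm
    _ ≤ μ univ := measure_mono (subset_univ _)
    _ = ν t := by rw [hμ _ .univ, hν _ ht]
    _ ≤ ν univ := measure_mono (subset_univ _)
    _ = B univ univ := hν _ .univ

theorem sum_preimage (hB : IsBimeasure B) {α β : Type*} {f : X → α} {g : Y → β}
    (hf : ∀ a, MeasurableSet (f ⁻¹' {a})) (hg : ∀ b, MeasurableSet (g ⁻¹' {b}))
    (S : Finset α) (T : Finset β) :
    ∑ a ∈ S, ∑ b ∈ T, B (f ⁻¹' {a}) (g ⁻¹' {b}) = B (f ⁻¹' S) (g ⁻¹' T) := by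
  have hT : MeasurableSet (g ⁻¹' T) := by
    rw [← Finset.set_biUnion_preimage_singleton]
    exact Finset.measurableSet_biUnion _ fun b _ => hg b
  have hS : MeasurableSet (f ⁻¹' S) := by
    rw [← Finset.set_biUnion_preimage_singleton]
    exact Finset.measurableSet_biUnion _ fun a _ => hf a
  obtain ⟨μ, hμ⟩ := hB.left _ hT
  rw [← hμ _ hS, ← sum_measure_preimage_singleton S fun a _ => hf a]
  refine Finset.sum_congr rfl fun a _ => ?_
  obtain ⟨ν, hν⟩ := hB.right _ (hf a)
  rw [hμ _ (hf a), ← hν _ hT, ← sum_measure_preimage_singleton T fun b _ => hg b]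
  exact Finset.sum_congr rfl fun b _ => (hν _ (hg b)).symm

theorem comp_preimage (hB : IsBimeasure B) {X' Y' : Type*} [MeasurableSpace X']
    [MeasurableSpace Y'] {f : X → X'} {g : Y → Y'} (hf : Measurable f) (hg : Measurable g) :
    IsBimeasure fun s t => B (f ⁻¹' s) (g ⁻¹' t) where
  left t ht := by
    obtain ⟨μ, hμ⟩ := hB.left _ (hg ht)
    exact ⟨μ.map f, fun s hs => by rw [Measure.map_apply hf hs, hμ _ (hf hs)]⟩
  right s hs := by
    obtain ⟨μ, hμ⟩ := hB.right _ (hf hs)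
    exact ⟨μ.map g, fun t ht => by rw [Measure.map_apply hg ht, hμ _ (hg ht)]⟩

theorem const_mul (hB : IsBimeasure B) (c : ℝ≥0∞) : IsBimeasure fun s t => c * B s t where
  left t ht := by
    obtain ⟨μ, hμ⟩ := hB.left t ht
    exact ⟨c • μ, fun s hs => by simp [hμ s hs]⟩
  right s hs := by
    obtain ⟨μ, hμ⟩ := hB.right s hs
    exact ⟨c • μ, fun t ht => by simp [hμ t ht]⟩

/-- A measure and a finite bimeasure which agree on the rectangles with sides in two generating
π-systems agree on all measurable rectangles. -/
theorem eq_of_generateFrom (hB : IsBimeasure B) (hfin : B univ univ ≠ ∞) (μ : Measure (X × Y))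
    {C : Set (Set X)} {D : Set (Set Y)}
    (hCgen : ‹MeasurableSpace X› = MeasurableSpace.generateFrom C) (hC : IsPiSystem C)
    (hDgen : ‹MeasurableSpace Y› = MeasurableSpace.generateFrom D) (hD : IsPiSystem D)
    (hCu : univ ∈ C) (hDu : univ ∈ D)
    (h : ∀ s ∈ C, ∀ t ∈ D, μ (s ×ˢ t) = B s t) {s : Set X} {t : Set Y}
    (hs : MeasurableSet s) (ht : MeasurableSet t) : μ (s ×ˢ t) = B s t := by
  have hCm : ∀ s ∈ C, MeasurableSet s := fun s hs => by
    rw [hCgen]; exact MeasurableSpace.measurableSet_generateFrom hs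
  have hDm : ∀ s ∈ D, MeasurableSet s := fun s hs => by
    rw [hDgen]; exact MeasurableSpace.measurableSet_generateFrom hs
  -- The two π-systems are dealt with one after the other, the other side being fixed.
  have hstep : ∀ s, MeasurableSet s → ∀ t ∈ D, μ (s ×ˢ t) = B s t := by
    intro s hs t ht
    obtain ⟨ν, hν⟩ := hB.left t (hDm t ht)
    have hap : ∀ s, MeasurableSet s →
        ((μ.restrict (univ ×ˢ t)).map Prod.fst) s = μ (s ×ˢ t) := fun s hs => by
      rw [Measure.map_apply measurable_fst hs, Measure.restrict_apply (measurable_fst hs)]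
      congr 1
      ext; simp
    have : IsFiniteMeasure ν :=
      ⟨by rw [hν _ .univ]; exact (hB.le_univ .univ (hDm t ht)).trans_lt hfin.lt_top⟩
    have heq : ν = (μ.restrict (univ ×ˢ t)).map Prod.fst := by
      refine ext_of_generate_finite C hCgen hC (fun s hs => ?_) ?_
      · rw [hap s (hCm s hs), hν s (hCm s hs), h s hs t ht]
      · rw [hap _ .univ, hν _ .univ, h _ hCu t ht]
    rw [← hap s hs, ← heq, hν s hs]
  obtain ⟨ν, hν⟩ := hB.right s hs
  have hap : ∀ t, MeasurableSet t →
      ((μ.restrict (s ×ˢ univ)).map Prod.snd) t = μ (s ×ˢ t) := fun t ht => by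
    rw [Measure.map_apply measurable_snd ht, Measure.restrict_apply (measurable_snd ht)]
    congr 1
    ext; simp [and_comm]
  have : IsFiniteMeasure ν :=
    ⟨by rw [hν _ .univ]; exact (hB.le_univ hs .univ).trans_lt hfin.lt_top⟩
  have heq : ν = (μ.restrict (s ×ˢ univ)).map Prod.snd := by
    refine ext_of_generate_finite D hDgen hD (fun t ht => ?_) ?_
    · rw [hap t (hDm t ht), hν t (hDm t ht), hstep s hs t ht]
    · rw [hap _ .univ, hν _ .univ, hstep s hs _ hDu]
  rw [← hap t ht, ← heq, hν t ht]

end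

section Cantor

variable {B : Set (ℕ → Bool) → Set (ℕ → Bool) → ℝ≥0∞}

/-- The atomic measure on the square of the Cantor space which gives each pair of cylinders over
the first `n` coordinates the mass prescribed by `B`. -/
noncomputable def atomicApprox (B : Set (ℕ → Bool) → Set (ℕ → Bool) → ℝ≥0∞) (n : ℕ) :
    Measure ((ℕ → Bool) × (ℕ → Bool)) :=
  ∑ a : Fin n → Bool, ∑ b : Fin n → Bool,
    B (firstCoords n ⁻¹' {a}) (firstCoords n ⁻¹' {b}) •
      Measure.dirac (extendFalse n a, extendFalse n b)

/-- The atomic approximation has the prescribed mass on a rectangle of cylinders over coordinates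
below `n`, since such cylinders are disjoint unions of cylinders over the first `n` coordinates. -/
theorem atomicApprox_cylinder (hB : IsBimeasure B) {I J : Finset ℕ} {n : ℕ}
    (hI : ∀ i ∈ I, i < n) (hJ : ∀ j ∈ J, j < n) (S : Set (I → Bool))
    (T : Set (J → Bool)) :
    atomicApprox B n (cylinder I S ×ˢ cylinder J T) = B (cylinder I S) (cylinder J T) := by
  classical
  have hS : MeasurableSet (cylinder (α := fun _ => Bool) I S) :=
    (isClopen_cylinder_bool I S).isOpen.measurableSet
  have hT : MeasurableSet (cylinder (α := fun _ => Bool) J T) :=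
    (isClopen_cylinder_bool J T).isOpen.measurableSet
  have hpre : ∀ (K : Finset ℕ) (R : Set (K → Bool)), (∀ i ∈ K, i < n) →
      cylinder K R = firstCoords n ⁻¹'
        ((Finset.univ.filter fun a => extendFalse n a ∈ cylinder (α := fun _ => Bool) K R :
          Finset (Fin n → Bool)) : Set (Fin n → Bool)) := fun K R hK => by
    ext x
    simp only [mem_preimage, Finset.coe_filter, Finset.mem_univ, true_and, mem_ofPred_eq]
    exact (mem_cylinder_extendFalse_iff hK R x).symm
  conv_rhs => rw [hpre I S hI, hpre J T hJ]
  have hmeas : ∀ a, MeasurableSet (firstCoords n ⁻¹' {a}) := fun a =>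
    measurable_firstCoords n (MeasurableSet.singleton a)
  rw [← hB.sum_preimage hmeas hmeas]
  simp only [atomicApprox, Measure.coe_finsetSum, Finset.sum_apply, Measure.smul_apply,
    Measure.dirac_apply' _ (hS.prod hT), smul_eq_mul, Finset.sum_filter]
  refine Finset.sum_congr rfl fun a _ => ?_
  by_cases ha : extendFalse n a ∈ cylinder (α := fun _ => Bool) I S
  · rw [if_pos ha]
    refine Finset.sum_congr rfl fun b _ => ?_
    by_cases hb : extendFalse n b ∈ cylinder (α := fun _ => Bool) J T <;>
      simp [ha, hb, -mem_cylinder]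
  · simp [ha, -mem_cylinder]

theorem exists_measure_cantor (hB : IsBimeasure B) (h1 : B univ univ = 1) :
    ∃ μ : Measure ((ℕ → Bool) × (ℕ → Bool)), ∀ s t, MeasurableSet s → MeasurableSet t →
      μ (s ×ˢ t) = B s t := by
  have hprob : ∀ n, IsProbabilityMeasure (atomicApprox B n) := fun n => ⟨by
    have := atomicApprox_cylinder hB (I := ∅) (J := ∅) (n := n) (by simp) (by simp) univ univ
    rwa [cylinder_univ, univ_prod_univ, h1] at this⟩
  let P : ℕ → ProbabilityMeasure ((ℕ → Bool) × (ℕ → Bool)) := fun n => ⟨atomicApprox B n, hprob n⟩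
  -- A limit point exists because the space of probability measures is compact.
  obtain ⟨μ, -, hμ⟩ := isCompact_univ.ultrafilter_le_nhds
    ((hyperfilter ℕ).map P) (by simp)
  have hlim : Tendsto P (hyperfilter ℕ : Filter ℕ) (𝓝 μ) := hμ
  refine ⟨μ, fun s t hs ht => hB.eq_of_generateFrom (by simp [h1]) μ
    generateFrom_measurableCylinders.symm isPiSystem_measurableCylinders
    generateFrom_measurableCylinders.symm isPiSystem_measurableCylinders
    (univ_mem_measurableCylinders _) (univ_mem_measurableCylinders _) ?_ hs ht⟩
  intro s hs t ht
  obtain ⟨I, S, -, rfl⟩ := (mem_measurableCylinders _).1 hs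
  obtain ⟨J, T, -, rfl⟩ := (mem_measurableCylinders _).1 ht
  have hcl := (isClopen_cylinder_bool I S).prod (isClopen_cylinder_bool J T)
  have h2 := ProbabilityMeasure.tendsto_measure_of_isClopen_of_tendsto hlim hcl
  have h3 : Tendsto (fun n => ((P n : Measure ((ℕ → Bool) × (ℕ → Bool)))
      (cylinder I S ×ˢ cylinder J T))) (hyperfilter ℕ : Filter ℕ)
      (𝓝 ((μ : Measure ((ℕ → Bool) × (ℕ → Bool))) (cylinder I S ×ˢ cylinder J T))) := by
    have := ENNReal.tendsto_coe.2 h2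
    simpa only [ProbabilityMeasure.ennreal_coeFn_eq_coeFn_toMeasure] using this
  refine tendsto_nhds_unique h3 (tendsto_const_nhds.congr' ?_)
  obtain ⟨N, hN⟩ := (I ∪ J).bddAbove
  have : ∀ᶠ n in (hyperfilter ℕ : Filter ℕ), N < n :=
    Nat.hyperfilter_le_atTop (eventually_gt_atTop N)
  filter_upwards [this] with n hn
  refine (atomicApprox_cylinder hB (fun i hi => ?_) (fun j hj => ?_) S T).symm
  · exact (hN (by simp [hi])).trans_lt hn
  · exact (hN (by simp [hj])).trans_lt hn

end Cantor

/-- A finite positive bimeasure on two locally compact, Hausdorff, second countable spaces is the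
restriction to the measurable rectangles of a measure on the product. -/
theorem exists_measure {X Y : Type*} [TopologicalSpace X] [T2Space X]
    [LocallyCompactSpace X] [SecondCountableTopology X] [MeasurableSpace X] [BorelSpace X]
    [TopologicalSpace Y] [T2Space Y]
    [LocallyCompactSpace Y] [SecondCountableTopology Y] [MeasurableSpace Y] [BorelSpace Y]
    {B : Set X → Set Y → ℝ≥0∞} (hB : IsBimeasure B) (hfin : B univ univ ≠ ∞) :
    ∃ μ : Measure (X × Y), ∀ s t, MeasurableSet s → MeasurableSet t → μ (s ×ˢ t) = B s t := by
  by_cases h0 : B univ univ = 0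
  · refine ⟨0, fun s t hs ht => ?_⟩
    have := hB.le_univ hs ht
    rw [h0] at this
    simpa using (nonpos_iff_eq_zero.1 this).symm
  obtain ⟨f, hf⟩ := exists_measurableEmbedding_natBool X
  obtain ⟨g, hg⟩ := exists_measurableEmbedding_natBool Y
  -- The bimeasure is normalized, as the compactness argument is about probability measures.
  obtain ⟨μ, hμ⟩ := ((hB.const_mul (B univ univ)⁻¹).comp_preimage hf.measurable
    hg.measurable).exists_measure_cantor (ENNReal.inv_mul_cancel h0 hfin)
  -- The pullback has the right values because the image of a rectangle is a rectangle.
  refine ⟨B univ univ • μ.comap (Prod.map f g), fun s t hs ht => ?_⟩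
  rw [Measure.smul_apply, (hf.prodMap hg).comap_apply, prodMap_image_prod,
    hμ _ _ (hf.measurableSet_image' hs) (hg.measurableSet_image' ht),
    preimage_image_eq _ hf.injective, preimage_image_eq _ hg.injective, smul_eq_mul, ← mul_assoc,
    ENNReal.mul_inv_cancel h0 hfin, one_mul]

end IsBimeasure

end Bimeasure

/-! ### Naimark dilation -/

namespace POVM
variable {X : Type*} [MeasurableSpace X] {H : Type*} [NormedAddCommGroup H] [InnerProductSpace ℂ H]

/-- The kernel `(i, j) ↦ F(Aᵢ ∩ Aⱼ)` is positive semidefinite. Splitting the space into the atoms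
of the finite algebra generated by the sets `Aᵢ`, on which the indicator functions of the `Aᵢ` are
constant, turns the double sum into a sum of values of the quadratic forms of the positive
operators `F(atom)`. -/
theorem sum_inner_op_inter_nonneg (F : POVM X H) {ι : Type*} (S : Finset ι) (A : ι → Set X)
    (hA : ∀ i, MeasurableSet (A i)) (x : ι → H) :
    0 ≤ (∑ i ∈ S, ∑ j ∈ S, ⟪x i, F.op (A i ∩ A j) (x j)⟫_ℂ).re := by
  classical
  -- `atom u` is the set of points that lie in exactly those `A i`, `i ∈ S`, for which `i ∈ u`.
  let atom : Finset ι → Set X := fun u => {p | ∀ i ∈ S, (p ∈ A i ↔ i ∈ u)}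
  have hatom : ∀ u, MeasurableSet (atom u) := fun u => by
    have : atom u = ⋂ i ∈ S, if i ∈ u then A i else (A i)ᶜ := by
      ext p
      simp only [atom, mem_ofPred_eq, mem_iInter]
      refine forall₂_congr fun i _ => ?_
      by_cases hi : i ∈ u <;> simp [hi]
    rw [this]
    refine Finset.measurableSet_biInter _ fun i _ => ?_
    split_ifs
    exacts [hA i, (hA i).compl]
  have hdisj : ((S.powerset : Finset (Finset ι)) : Set (Finset ι)).PairwiseDisjoint atom := by
    intro u hu v hv huv
    refine Set.disjoint_left.2 fun p hpu hpv => huv ?_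
    ext i
    simp only [Finset.coe_powerset, mem_preimage, mem_powerset_iff, Finset.coe_subset] at hu hv
    constructor
    · intro hi; exact (hpv i (hu hi)).1 ((hpu i (hu hi)).2 hi)
    · intro hi; exact (hpu i (hv hi)).1 ((hpv i (hv hi)).2 hi)
  -- `A i ∩ A j` is the union of the atoms with `i ∈ u` and `j ∈ u`.
  have hsplit : ∀ i ∈ S, ∀ j ∈ S, F.op (A i ∩ A j) =
      ∑ u ∈ S.powerset, if i ∈ u ∧ j ∈ u then F.op (atom u) else 0 := by
    intro i hi j hj
    rw [← Finset.sum_filter, ← F.op_biUnion_finset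
      (hdisj.subset (by exact_mod_cast Finset.filter_subset _ _)) fun u _ => hatom u]
    congr 1
    ext p
    simp only [mem_inter_iff, Finset.mem_filter, Finset.mem_powerset, mem_iUnion, exists_prop]
    constructor
    · rintro ⟨hpi, hpj⟩
      refine ⟨S.filter fun k => p ∈ A k, ⟨Finset.filter_subset _ _, by simp [hi, hpi],
        by simp [hj, hpj]⟩, fun k hk => by simp [hk]⟩
    · rintro ⟨u, ⟨-, hiu, hju⟩, hp⟩
      exact ⟨(hp i hi).2 hiu, (hp j hj).2 hju⟩
  have hsum : ∑ i ∈ S, ∑ j ∈ S, ⟪x i, F.op (A i ∩ A j) (x j)⟫_ℂ =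
      ∑ u ∈ S.powerset, ⟪∑ i ∈ S, (if i ∈ u then x i else 0),
        F.op (atom u) (∑ j ∈ S, if j ∈ u then x j else 0)⟫_ℂ := by
    have h1 : ∀ i ∈ S, ∀ j ∈ S, ⟪x i, F.op (A i ∩ A j) (x j)⟫_ℂ = ∑ u ∈ S.powerset,
        ⟪if i ∈ u then x i else 0, F.op (atom u) (if j ∈ u then x j else 0)⟫_ℂ := by
      intro i hi j hj
      rw [hsplit i hi j hj, sum_apply, inner_sum]
      refine Finset.sum_congr rfl fun u _ => ?_
      by_cases h1 : i ∈ u <;> by_cases h2 : j ∈ u <;> simp [h1, h2]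
    rw [Finset.sum_congr rfl fun i hi => Finset.sum_congr rfl fun j hj => h1 i hi j hj]
    rw [Finset.sum_congr rfl fun i _ => Finset.sum_comm, Finset.sum_comm]
    refine Finset.sum_congr rfl fun u _ => ?_
    simp only [sum_inner, map_sum, inner_sum]
    exact Finset.sum_comm
  rw [hsum, Complex.re_sum]
  refine Finset.sum_nonneg fun u _ => ?_
  rw [← F.inner_op_comm (hatom u)]
  exact F.re_inner_op_self_nonneg (hatom u) _

/-- Formal finite sums `∑ χ_A ⊗ x` with `A` a measurable set and `x` a vector; the completion of
this space for the scalar product `⟪χ_A ⊗ x, χ_B ⊗ y⟫ = ⟪x, F(A ∩ B) y⟫` is the dilation space.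
The index set is lifted to an arbitrary larger universe. -/
def PreDilation.{r, a, b} {X : Type a} [MeasurableSpace X] {H : Type b} [NormedAddCommGroup H]
    [InnerProductSpace ℂ H] (_F : POVM X H) : Type (max r a b) :=
  ULift.{r} {s : Set X // MeasurableSet s} →₀ H

namespace PreDilation

universe r

variable {F : POVM X H}

noncomputable instance : AddCommGroup (PreDilation.{r} F) :=
  inferInstanceAs (AddCommGroup (ULift.{r} {s : Set X // MeasurableSet s} →₀ H))

noncomputable instance : Module ℂ (PreDilation.{r} F) :=
  inferInstanceAs (Module ℂ (ULift.{r} {s : Set X // MeasurableSet s} →₀ H))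

/-- The sesquilinear form `⟪χ_A ⊗ x, χ_B ⊗ y⟫ = ⟪x, F(A ∩ B) y⟫`. -/
noncomputable def form (f g : PreDilation.{r} F) : ℂ :=
  Finsupp.sum f fun a x => Finsupp.sum g fun b y => ⟪x, F.op (a.down ∩ b.down) y⟫_ℂ

noncomputable instance : PreInnerProductSpace.Core ℂ (PreDilation.{r} F) where
  inner := form
  conj_inner_symm f g := by
    simp only [form, Finsupp.sum, map_sum, inner_conj_symm]
    rw [Finset.sum_comm]
    refine Finset.sum_congr rfl fun a _ => Finset.sum_congr rfl fun b _ => ?_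
    rw [F.inner_op_comm (b.down.2.inter a.down.2), inter_comm]
  re_inner_nonneg f :=
    F.sum_inner_op_inter_nonneg f.support (fun a => (a.down : Set X)) (fun a => a.down.2)
      (DFunLike.coe (F := ULift.{r} {s : Set X // MeasurableSet s} →₀ H) f)
  add_left f g h := by
    refine Finsupp.sum_add_index' (fun a => by simp [Finsupp.sum]) fun a x y => ?_
    simp only [inner_add_left]
    exact Finsupp.sum_add
  smul_left f g c := by
    refine (Finsupp.sum_smul_index' fun a => by simp [Finsupp.sum]).trans ?_
    simp only [form, Finsupp.sum, Finset.mul_sum, inner_smul_left]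

noncomputable instance : SeminormedAddCommGroup (PreDilation.{r} F) :=
  InnerProductSpace.Core.toSeminormedAddCommGroup (𝕜 := ℂ)

noncomputable instance : InnerProductSpace ℂ (PreDilation.{r} F) :=
  InnerProductSpace.ofCore inferInstance

theorem inner_def (f g : PreDilation.{r} F) : ⟪f, g⟫_ℂ = form f g := rfl

/-- Multiplication by the indicator function of a measurable set `s`, which maps `χ_A ⊗ x` to
`χ_{s ∩ A} ⊗ x`. -/
noncomputable def mulIndicatorₗ (s : {s : Set X // MeasurableSet s}) :
    PreDilation.{r} F →ₗ[ℂ] PreDilation.{r} F :=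
  Finsupp.lmapDomain H ℂ fun a => ⟨⟨s ∩ a.down, s.2.inter a.down.2⟩⟩

theorem mulIndicatorₗ_mulIndicatorₗ (s t : {s : Set X // MeasurableSet s})
    (f : PreDilation.{r} F) :
    mulIndicatorₗ s (mulIndicatorₗ t f) = mulIndicatorₗ ⟨s ∩ t, s.2.inter t.2⟩ f := by
  refine Finsupp.mapDomain_comp.symm.trans ?_
  simp only [mulIndicatorₗ, Function.comp_def, inter_assoc]
  rfl

theorem mulIndicatorₗ_univ (f : PreDilation.{r} F) :
    mulIndicatorₗ ⟨univ, .univ⟩ f = f := by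
  simp only [mulIndicatorₗ, univ_inter]
  exact Finsupp.mapDomain_id

theorem inner_mulIndicatorₗ_left (s : {s : Set X // MeasurableSet s}) (f g : PreDilation.{r} F) :
    ⟪mulIndicatorₗ s f, g⟫_ℂ = Finsupp.sum f fun a x => Finsupp.sum g fun b y =>
      ⟪x, F.op (s ∩ (a.down ∩ b.down)) y⟫_ℂ := by
  rw [inner_def, form, mulIndicatorₗ]
  refine (Finsupp.sum_mapDomain_index (fun a => by simp [Finsupp.sum]) fun a x y => ?_).trans ?_
  · simp only [inner_add_left]
    exact Finsupp.sum_add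
  · simp only [inter_assoc]

theorem isSymmetric_mulIndicatorₗ (s : {s : Set X // MeasurableSet s}) :
    (mulIndicatorₗ s : PreDilation.{r} F →ₗ[ℂ] PreDilation.{r} F).IsSymmetric := fun f g => by
  rw [← inner_conj_symm f, inner_mulIndicatorₗ_left, inner_mulIndicatorₗ_left]
  simp only [Finsupp.sum, map_sum, inner_conj_symm]
  rw [Finset.sum_comm]
  refine Finset.sum_congr rfl fun a _ => Finset.sum_congr rfl fun b _ => ?_
  rw [F.inner_op_comm (s.2.inter (a.down.2.inter b.down.2)), inter_comm (a.down : Set X)]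

/-- Multiplication by an indicator function, as a contraction. -/
noncomputable def mulIndicator (s : {s : Set X // MeasurableSet s}) :
    PreDilation.{r} F →L[ℂ] PreDilation.{r} F :=
  (mulIndicatorₗ s).mkContinuous 1 fun f => by
    rw [one_mul]
    refine (isSymmetric_mulIndicatorₗ s).norm_apply_le_of_idempotent (fun g => ?_) f
    rw [mulIndicatorₗ_mulIndicatorₗ]
    simp only [inter_self]

theorem mulIndicator_apply (s : {s : Set X // MeasurableSet s}) (f : PreDilation.{r} F) :
    mulIndicator s f = mulIndicatorₗ s f := rfl

theorem hasSum_inner_mulIndicator {s : ℕ → Set X} (hs : ∀ i, MeasurableSet (s i))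
    (hd : Pairwise (Function.onFun Disjoint s)) (f g : PreDilation.{r} F) :
    HasSum (fun i => ⟪mulIndicator ⟨s i, hs i⟩ f, g⟫_ℂ)
      ⟪mulIndicator ⟨⋃ i, s i, .iUnion hs⟩ f, g⟫_ℂ := by
  simp only [mulIndicator_apply, inner_mulIndicatorₗ_left, Finsupp.sum]
  refine hasSum_sum fun a _ => hasSum_sum fun b _ => ?_
  rw [iUnion_inter]
  refine F.hasSum_inner_op (fun i => (hs i).inter (a.down.2.inter b.down.2)) (fun i j hij => ?_) _ _
  exact (hd hij).mono inter_subset_left inter_subset_left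

/-- The embedding `x ↦ χ_X ⊗ x` of the original space. -/
noncomputable def embed (F : POVM X H) : H →ₗᵢ[ℂ] PreDilation.{r} F where
  toLinearMap := Finsupp.lsingle ⟨⟨univ, .univ⟩⟩
  norm_map' x := by
    rw [← sq_eq_sq₀ (norm_nonneg _) (norm_nonneg _), ← inner_self_eq_norm_sq (𝕜 := ℂ),
      ← inner_self_eq_norm_sq (𝕜 := ℂ), inner_def, form]
    erw [Finsupp.sum_single_index (by simp [Finsupp.sum]), Finsupp.sum_single_index (by simp)]
    simp [op_univ]

theorem inner_embed_mulIndicator_embed (s : {s : Set X // MeasurableSet s}) (x y : H) :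
    ⟪mulIndicator s (embed.{r} F x), embed F y⟫_ℂ = ⟪F.op s x, y⟫_ℂ := by
  rw [mulIndicator_apply, inner_mulIndicatorₗ_left, F.inner_op_comm s.2]
  erw [Finsupp.sum_single_index (by simp [Finsupp.sum]), Finsupp.sum_single_index (by simp)]
  simp

end PreDilation

section Dilation

universe r

variable (F : POVM X H)

/-- Multiplication by an indicator function on the dilation space. -/
noncomputable def dilationOp (s : {s : Set X // MeasurableSet s}) :
    UniformSpace.Completion (PreDilation.{r} F) →L[ℂ] UniformSpace.Completion (PreDilation.{r} F) :=
  (PreDilation.mulIndicator s).completion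

theorem dilationOp_coe (s : {s : Set X // MeasurableSet s}) (f : PreDilation.{r} F) :
    dilationOp F s (f : UniformSpace.Completion (PreDilation.{r} F)) =
      (PreDilation.mulIndicator s f : PreDilation.{r} F) :=
  ContinuousLinearMap.completion_apply_coe _ _

theorem dilationOp_dilationOp (s t : {s : Set X // MeasurableSet s})
    (ξ : UniformSpace.Completion (PreDilation.{r} F)) :
    dilationOp F s (dilationOp F t ξ) = dilationOp F ⟨s ∩ t, s.2.inter t.2⟩ ξ := by
  refine UniformSpace.Completion.induction_on ξ (isClosed_eq (by fun_prop) (by fun_prop))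
    fun f => ?_
  simp only [dilationOp_coe, PreDilation.mulIndicator_apply,
    PreDilation.mulIndicatorₗ_mulIndicatorₗ]

theorem dilationOp_univ :
    dilationOp.{r} F ⟨univ, .univ⟩ = ContinuousLinearMap.id ℂ _ := by
  ext ξ
  refine UniformSpace.Completion.induction_on ξ (isClosed_eq (by fun_prop) (by fun_prop))
    fun f => ?_
  simp only [dilationOp_coe, PreDilation.mulIndicator_apply, PreDilation.mulIndicatorₗ_univ,
    ContinuousLinearMap.id_apply]

theorem isSymmetric_dilationOp (s : {s : Set X // MeasurableSet s}) :
    (dilationOp.{r} F s).IsSymmetric := fun ξ η => by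
  refine UniformSpace.Completion.induction_on₂ ξ η
    (isClosed_eq (by simp; fun_prop) (by simp; fun_prop))
    fun f g => ?_
  simp only [ContinuousLinearMap.coe_coe, dilationOp_coe, UniformSpace.Completion.inner_coe]
  exact PreDilation.isSymmetric_mulIndicatorₗ s f g

theorem dilationOp_empty : dilationOp.{r} F ⟨∅, .empty⟩ = 0 := by
  refine ContinuousLinearMap.ext_inner_self fun ξ => ?_
  refine UniformSpace.Completion.induction_on ξ (isClosed_eq (by fun_prop) (by fun_prop))
    fun f => ?_
  rw [dilationOp_coe, UniformSpace.Completion.inner_coe, PreDilation.mulIndicator_apply,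
    PreDilation.inner_mulIndicatorₗ_left]
  simp [op_empty, Finsupp.sum]

theorem dilationOp_eq_zero {s : {s : Set X // MeasurableSet s}} (hs : (s : Set X) = ∅) :
    dilationOp.{r} F s = 0 := by
  rw [← dilationOp_empty]
  congr 1
  exact Subtype.ext hs

theorem isPositive_dilationOp (s : {s : Set X // MeasurableSet s}) :
    (dilationOp.{r} F s).IsPositive := by
  refine ⟨isSymmetric_dilationOp F s, fun ξ => ?_⟩
  have h : ⟪dilationOp F s ξ, ξ⟫_ℂ = ⟪dilationOp F s ξ, dilationOp F s ξ⟫_ℂ := by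
    have h1 := isSymmetric_dilationOp F s (dilationOp F s ξ) ξ
    simp only [ContinuousLinearMap.coe_coe, dilationOp_dilationOp, inter_self] at h1
    exact h1
  rw [ContinuousLinearMap.reApplyInnerSelf_apply, h]
  exact inner_self_nonneg

/-- A finite sum of the projections of disjoint sets is a symmetric idempotent, whence a
contraction. -/
theorem norm_sum_dilationOp_le {f : ℕ → Set X} (hm : ∀ i, MeasurableSet (f i))
    (hd : Pairwise (Function.onFun Disjoint f)) (u : Finset ℕ)
    (ξ : UniformSpace.Completion (PreDilation.{r} F)) :
    ‖(∑ i ∈ u, dilationOp F ⟨f i, hm i⟩) ξ‖ ≤ ‖ξ‖ := by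
  have hsym : (∑ i ∈ u, dilationOp F ⟨f i, hm i⟩).IsSymmetric :=
    (ContinuousLinearMap.isPositive_sum _ fun i _ => isPositive_dilationOp F _).isSymmetric
  refine hsym.norm_apply_le_of_idempotent (fun η => ?_) ξ
  simp only [ContinuousLinearMap.coe_coe, sum_apply, map_sum, dilationOp_dilationOp]
  refine Finset.sum_congr rfl fun i hi => ?_
  rw [Finset.sum_eq_single_of_mem i hi]
  · simp only [inter_self]
  · intro j _ hj
    rw [dilationOp_eq_zero F (by exact (hd hj).inter_eq), zero_apply]

theorem hasSum_inner_dilationOp {f : ℕ → Set X} (hm : ∀ i, MeasurableSet (f i))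
    (hd : Pairwise (Function.onFun Disjoint f))
    (ξ : UniformSpace.Completion (PreDilation.{r} F)) :
    HasSum (fun i => ⟪dilationOp F ⟨f i, hm i⟩ ξ, ξ⟫_ℂ)
      ⟪dilationOp F ⟨⋃ i, f i, .iUnion hm⟩ ξ, ξ⟫_ℂ := by
  have h := tendsto_inner_of_dense (l := atTop)
    (T := fun u : Finset ℕ => ∑ i ∈ u, dilationOp.{r} F ⟨f i, hm i⟩)
    (S := dilationOp.{r} F ⟨⋃ i, f i, .iUnion hm⟩)
    (norm_sum_dilationOp_le F hm hd) UniformSpace.Completion.denseRange_coe (by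
      rintro _ ⟨g, rfl⟩ _ ⟨g', rfl⟩
      simp only [sum_apply, sum_inner, dilationOp_coe, UniformSpace.Completion.inner_coe]
      exact PreDilation.hasSum_inner_mulIndicator hm hd g g') ξ ξ
  simp only [sum_apply, sum_inner] at h
  exact h

end Dilation

/-- Naimark's dilation theorem: a POVM is the compression of a PVM on a larger Hilbert space. The
equation `E(s)E(t) = E(s ∩ t)` is the multiplicativity of the PVM `E`. -/
theorem exists_naimark.{r, a, b} {X : Type a} [MeasurableSpace X] {H : Type b}
    [NormedAddCommGroup H] [InnerProductSpace ℂ H] (F : POVM X H) :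
    ∃ (K : Type (max r a b)) (_ : NormedAddCommGroup K) (_ : InnerProductSpace ℂ K)
      (_ : CompleteSpace K) (V : H →ₗᵢ[ℂ] K) (E : POVM X K),
      (∀ s t, MeasurableSet s → MeasurableSet t → E.op s ∘L E.op t = E.op (s ∩ t)) ∧
      ∀ s, MeasurableSet s → ∀ x y, ⟪E.op s (V x), V y⟫_ℂ = ⟪F.op s x, y⟫_ℂ := by
  classical
  let T : Set X → (UniformSpace.Completion (PreDilation.{r} F) →L[ℂ] _) := fun s =>
    if hs : MeasurableSet s then dilationOp F ⟨s, hs⟩ else 0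
  have hT : ∀ s (hs : MeasurableSet s), T s = dilationOp F ⟨s, hs⟩ := fun s hs => dif_pos hs
  let E : POVM X (UniformSpace.Completion (PreDilation.{r} F)) := ofOp T
    (fun s hs => by rw [hT s hs]; exact isPositive_dilationOp F _)
    (by rw [hT _ .univ, dilationOp_univ])
    (fun f hm hd ξ => by
      simp only [hT _ (hm _), hT _ (MeasurableSet.iUnion hm)]
      exact hasSum_inner_dilationOp F hm hd ξ)
  have hE : ∀ s (hs : MeasurableSet s), E.op s = dilationOp F ⟨s, hs⟩ := fun s hs => by
    rw [← hT s hs]; exact op_ofOp _ _ _ _ hs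
  refine ⟨UniformSpace.Completion (PreDilation.{r} F), inferInstance, inferInstance, inferInstance,
    (UniformSpace.Completion.toComplₗᵢ (𝕜 := ℂ)).comp (PreDilation.embed F), E, ?_, ?_⟩
  · intro s t hs ht
    rw [hE s hs, hE t ht, hE _ (hs.inter ht)]
    ext ξ
    exact dilationOp_dilationOp F _ _ ξ
  · intro s hs x y
    rw [hE s hs]
    change ⟪dilationOp F ⟨s, hs⟩ (PreDilation.embed F x : PreDilation.{r} F),
      ((PreDilation.embed F y : PreDilation.{r} F) :
        UniformSpace.Completion (PreDilation.{r} F))⟫_ℂ = _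
    rw [dilationOp_coe, UniformSpace.Completion.inner_coe]
    exact PreDilation.inner_embed_mulIndicator_embed ⟨s, hs⟩ x y

end POVM

/-! ### Commuting dilations and joint POVMs -/

namespace POVM

section

variable {X : Type*} [MeasurableSpace X] {H : Type*} [NormedAddCommGroup H] [InnerProductSpace ℂ H]

theorem IsPVM.op_op_self {E : POVM X H} (hE : E.IsPVM) {s : Set X} (hs : MeasurableSet s) (ξ : H) :
    E.op s (E.op s ξ) = E.op s ξ := by
  have h1 := DFunLike.congr_fun (hE s sᶜ hs hs.compl (inter_compl_self s)) ξ
  have h2 := E.op_union disjoint_compl_right hs hs.compl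
  rw [union_compl_self, op_univ] at h2
  have h3 : ξ = E.op s ξ + E.op sᶜ ξ := DFunLike.congr_fun h2 ξ
  have h4 : E.op s (E.op sᶜ ξ) = 0 := h1
  conv_rhs => rw [h3, map_add, h4, add_zero]

theorem IsPVM.inner_op_self {E : POVM X H} (hE : E.IsPVM) {s : Set X} (hs : MeasurableSet s)
    (ξ : H) : (⟪E.op s ξ, ξ⟫_ℂ).re = ‖E.op s ξ‖ ^ 2 := by
  rw [← hE.op_op_self hs, E.inner_op_comm hs, hE.op_op_self hs]
  exact inner_self_eq_norm_sq (𝕜 := ℂ) _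

theorem IsPVM.map {E : POVM X H} (hE : E.IsPVM) {Y : Type*} [MeasurableSpace Y] {f : X → Y}
    (hf : Measurable f) : (E.map f hf).IsPVM := fun s t hs ht hst => by
  rw [op_map _ _ hs, op_map _ _ ht, hE _ _ (hf hs) (hf ht)]
  rw [← preimage_inter, hst, preimage_empty]

/-- The projection of `ξ` onto the range of `V` is `V x` if and only if `ξ` and `x` have the same
scalar products with the vectors of `H`. Hence, in the definition of a Naimark dilation,
`F(s) = P E(s)` on `H` says that the sesquilinear form of `F(s)` is the restriction of that
of `E(s)`. -/
theorem starProjection_eq_iff [CompleteSpace H] {K : Type*} [NormedAddCommGroup K]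
    [InnerProductSpace ℂ K] (V : H →ₗᵢ[ℂ] K) (x : H) (ξ : K) :
    V x = (LinearMap.range V.toLinearMap).starProjection ξ ↔ ∀ y, ⟪ξ, V y⟫_ℂ = ⟪x, y⟫_ℂ := by
  have hmem : ∀ y, V y ∈ LinearMap.range V.toLinearMap := fun y => ⟨y, rfl⟩
  constructor
  · intro h y
    have h1 := Submodule.starProjection_inner_eq_zero (K := LinearMap.range V.toLinearMap) ξ
      (V y) (hmem y)
    rw [← h, inner_sub_left, V.inner_map_map, sub_eq_zero] at h1
    exact h1
  · intro h
    refine (Submodule.eq_starProjection_of_mem_of_inner_eq_zero (hmem x) ?_).symm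
    rintro _ ⟨y, rfl⟩
    change ⟪ξ - V x, V y⟫_ℂ = 0
    rw [inner_sub_left, V.inner_map_map, h, sub_self]

end

section Two

variable {X₁ X₂ : Type*} [MeasurableSpace X₁] [MeasurableSpace X₂]
  {H : Type*} [NormedAddCommGroup H] [InnerProductSpace ℂ H]

/-- For commuting PVMs, `‖E₁(s)E₂(t)ξ‖² = ⟪E₁(s)E₂(t)ξ, E₂(t)ξ⟫ = ⟪E₂(t)E₁(s)ξ, E₁(s)ξ⟫` is a
measure in each of the variables `s` and `t`. -/
theorem Commutes.isBimeasure {E₁ : POVM X₁ H} {E₂ : POVM X₂ H} (h : Commutes E₁ E₂)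
    (h₁ : E₁.IsPVM) (h₂ : E₂.IsPVM) (ξ : H) :
    IsBimeasure fun s t => ENNReal.ofReal (‖E₁.op s (E₂.op t ξ)‖ ^ 2) where
  left t ht := ⟨E₁.scalarMeasure (E₂.op t ξ), fun s hs => by
    rw [scalarMeasure_apply _ _ hs, h₁.inner_op_self hs]⟩
  right s hs := ⟨E₂.scalarMeasure (E₁.op s ξ), fun t ht => by
    rw [scalarMeasure_apply _ _ ht, h₂.inner_op_self ht]
    have : E₁.op s (E₂.op t ξ) = E₂.op t (E₁.op s ξ) := DFunLike.congr_fun (h s t hs ht) ξ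
    rw [this]⟩

theorem Commutes.inner_op_op_self {E₁ : POVM X₁ H} {E₂ : POVM X₂ H} (h : Commutes E₁ E₂)
    (h₁ : E₁.IsPVM) (h₂ : E₂.IsPVM) {s : Set X₁} {t : Set X₂} (hs : MeasurableSet s)
    (ht : MeasurableSet t) (ξ : H) :
    ⟪E₁.op s (E₂.op t ξ), ξ⟫_ℂ = ((‖E₁.op s (E₂.op t ξ)‖ ^ 2 : ℝ) : ℂ) := by
  have hc : E₁.op s (E₂.op t ξ) = E₂.op t (E₁.op s ξ) := DFunLike.congr_fun (h s t hs ht) ξ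
  have h3 : ⟪E₁.op s (E₂.op t ξ), E₁.op s (E₂.op t ξ)⟫_ℂ = ⟪E₁.op s (E₂.op t ξ), ξ⟫_ℂ := by
    rw [← E₁.inner_op_comm hs, h₁.op_op_self hs, ← E₂.inner_op_comm ht, hc, h₂.op_op_self ht]
  rw [← h3, inner_self_eq_norm_sq_to_K]
  push_cast
  rfl

end Two

/-- The compressions of two commuting PVMs are the marginals of the POVM whose scalar measures
extend the bimeasures `⟪E₁(s)E₂(t)Vx, Vx⟫`. -/
theorem compatible_of_commuting_dilations
    {X₁ : Type*} [TopologicalSpace X₁] [T2Space X₁] [LocallyCompactSpace X₁]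
    [SecondCountableTopology X₁] [MeasurableSpace X₁] [BorelSpace X₁]
    {X₂ : Type*} [TopologicalSpace X₂] [T2Space X₂] [LocallyCompactSpace X₂]
    [SecondCountableTopology X₂] [MeasurableSpace X₂] [BorelSpace X₂]
    {H : Type*} [NormedAddCommGroup H] [InnerProductSpace ℂ H] [CompleteSpace H]
    {F₁ : POVM X₁ H} {F₂ : POVM X₂ H}
    {K : Type*} [NormedAddCommGroup K] [InnerProductSpace ℂ K] [CompleteSpace K]
    {V : H →ₗᵢ[ℂ] K} {E₁ : POVM X₁ K} {E₂ : POVM X₂ K} (h₁ : IsNaimarkDilation V E₁ F₁)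
    (h₂ : IsNaimarkDilation V E₂ F₂) (hc : Commutes E₁ E₂) : Compatible F₁ F₂ := by
  have hF₁ : ∀ s, MeasurableSet s → ∀ x, ⟪E₁.op s (V x), V x⟫_ℂ = ⟪F₁.op s x, x⟫_ℂ :=
    fun s hs x => (starProjection_eq_iff V _ _).1 (h₁.2 s hs x) x
  have hF₂ : ∀ s, MeasurableSet s → ∀ x, ⟪E₂.op s (V x), V x⟫_ℂ = ⟪F₂.op s x, x⟫_ℂ :=
    fun s hs x => (starProjection_eq_iff V _ _).1 (h₂.2 s hs x) x
  choose μ hμ using fun x : H =>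
    (hc.isBimeasure h₁.1 h₂.1 (V x)).exists_measure ENNReal.ofReal_ne_top
  have hfin : ∀ x, IsFiniteMeasure (μ x) := fun x => ⟨by
    rw [← univ_prod_univ, hμ x _ _ .univ .univ]; exact ENNReal.ofReal_lt_top⟩
  have hreal : ∀ x s t, MeasurableSet s → MeasurableSet t →
      ⟪E₁.op s (E₂.op t (V x)), V x⟫_ℂ = (μ x).real (s ×ˢ t) := fun x s t hs ht => by
    rw [measureReal_def, hμ x s t hs ht, ENNReal.toReal_ofReal (sq_nonneg _),
      hc.inner_op_op_self h₁.1 h₂.1 hs ht]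
  obtain ⟨F, hF⟩ := exists_of_measures μ (fun x => by
      rw [← univ_prod_univ, measureReal_def, hμ x _ _ .univ .univ,
        ENNReal.toReal_ofReal (sq_nonneg _)]
      simp [op_univ])
    (image2 (· ×ˢ ·) {s : Set X₁ | MeasurableSet s} {t : Set X₂ | MeasurableSet t})
    generateFrom_prod.symm isPiSystem_prod (by
      rintro _ ⟨s, hs, t, ht, rfl⟩
      refine ⟨V.toContinuousLinearMap.adjoint ∘L E₁.op s ∘L E₂.op t ∘L V.toContinuousLinearMap,
        fun x => ?_⟩
      rw [← hreal x s t hs ht]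
      simp [ContinuousLinearMap.adjoint_inner_left])
  refine ⟨F, fun s hs => ?_, fun t ht => ?_⟩
  · refine ContinuousLinearMap.ext_inner_self fun x => ?_
    rw [hF _ (hs.prod .univ), ← hreal x s _ hs .univ, op_univ, ← hF₁ s hs]
    rfl
  · refine ContinuousLinearMap.ext_inner_self fun x => ?_
    rw [hF _ (MeasurableSet.univ.prod ht), ← hreal x _ t .univ ht, op_univ, ← hF₂ t ht]
    rfl

/-- The marginals of a Naimark dilation of a joint POVM commute, as the values of a PVM do. -/
theorem Compatible.exists_commuting_dilations.{r, a, b, c} {X₁ : Type a} {X₂ : Type b}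
    [MeasurableSpace X₁] [MeasurableSpace X₂]
    {H : Type c} [NormedAddCommGroup H] [InnerProductSpace ℂ H] [CompleteSpace H]
    {F₁ : POVM X₁ H} {F₂ : POVM X₂ H} (h : Compatible F₁ F₂) :
    ∃ (K : Type (max a b c r)) (_ : NormedAddCommGroup K) (_ : InnerProductSpace ℂ K)
      (_ : CompleteSpace K) (V : H →ₗᵢ[ℂ] K) (E₁ : POVM X₁ K) (E₂ : POVM X₂ K),
      IsNaimarkDilation V E₁ F₁ ∧ IsNaimarkDilation V E₂ F₂ ∧ Commutes E₁ E₂ := by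
  obtain ⟨F, hF₁, hF₂⟩ := h
  obtain ⟨K, _, _, _, V, E, hmul, hE⟩ := exists_naimark.{r} F
  have hpvm : E.IsPVM := fun s t hs ht hst => by rw [hmul s t hs ht, hst, op_empty]
  refine ⟨K, inferInstance, inferInstance, inferInstance, V, E.map _ measurable_fst,
    E.map _ measurable_snd, ⟨?_, fun s hs x => ?_⟩, ⟨?_, fun t ht x => ?_⟩, fun s t hs ht => ?_⟩
  · exact hpvm.map measurable_fst
  · rw [op_map _ _ hs, starProjection_eq_iff, hF₁ s hs, prod_univ]
    exact fun y => hE _ (measurable_fst hs) x y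
  · exact hpvm.map measurable_snd
  · rw [op_map _ _ ht, starProjection_eq_iff, hF₂ t ht, univ_prod]
    exact fun y => hE _ (measurable_snd ht) x y
  · rw [op_map _ _ hs, op_map _ _ ht, hmul _ _ (measurable_fst hs) (measurable_snd ht),
      hmul _ _ (measurable_snd ht) (measurable_fst hs), inter_comm]

end POVM

end CompatibleIffDilation

theorem mainTheorem2
    {X₁ : Type u} [TopologicalSpace X₁] [T2Space X₁] [LocallyCompactSpace X₁]
    [SecondCountableTopology X₁] [MeasurableSpace X₁] [BorelSpace X₁]
    {X₂ : Type v} [TopologicalSpace X₂] [T2Space X₂] [LocallyCompactSpace X₂]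
    [SecondCountableTopology X₂] [MeasurableSpace X₂] [BorelSpace X₂]
    {H : Type w} [NormedAddCommGroup H] [InnerProductSpace ℂ H] [CompleteSpace H]
    (F₁ : POVM X₁ H) (F₂ : POVM X₂ H) :
    POVM.Compatible F₁ F₂ ↔
      ∃ (K : Type (max u v w x)) (_ : NormedAddCommGroup K) (_ : InnerProductSpace ℂ K)
        (_ : CompleteSpace K) (V : H →ₗᵢ[ℂ] K) (E₁ : POVM X₁ K) (E₂ : POVM X₂ K),
        POVM.IsNaimarkDilation V E₁ F₁ ∧ POVM.IsNaimarkDilation V E₂ F₂ ∧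
          POVM.Commutes E₁ E₂ := 
  ⟨POVM.Compatible.exists_commuting_dilations.{x},
    fun ⟨_, _, _, _, _, _, _, h₁, h₂, hc⟩ => POVM.compatible_of_commuting_dilations h₁ h₂ hc⟩
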